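/- Let $d\ge 2$ and let $\{\tau_e\}$ be i.i.d. nonnegative random variables indexed by the edges of the nearest-neighbour lattice $\mathbb{Z}^d$. For $y,z\in\mathbb{Z}^d$ let $T(y,z)$ be the infimum of $\sum_{e\in\Gamma}\tau_e$ over all lattice paths $\Gamma$ from $y$ to $z$; let $\mu(z)$ be the time constant, i.e. the limit in probability of $T(0,nz)/n$ as $n\to\infty$ (which exists and is finite for every $z$), and write $\|\cdot\|$ for the $\ell^1$-norm. For $\varepsilon>0$ let $$\mathcal{Z}_\varepsilon=\{z\in\mathbb{Z}^d:|T(0,z)-\mu(z)|>\varepsilon\|z\|\},$$ and let $\mathcal{T}_\varepsilon$ be the set of times $t\ge0$ for which at least one of the two inclusions $$\{z\in\mathbb{Z}^d:\mu(z)\le(1-\varepsilon)t\}\subset\{z\in\mathbb{Z}^d:T(0,z)\le t\}\subset\{z\in\mathbb{Z}^d:\mu(z)\le(1+\varepsilon)t\}$$ fails. Let $Y$ be the minimum of $2d$ independent random variables distributed as $\tau_e$. If $\mathbb{E}[Y^d]=\infty$, then almost surely the following holds: for every $\varepsilon>0$ the set $\mathcal{Z}_\varepsilon$ is infinite, and for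 every $0<\varepsilon<1$ the set $\mathcal{T}_\varepsilon$ has infinite Lebesgue measure. -/

import Mathlib

open MeasureTheory ProbabilityTheory Filter

namespace FPP

/-- The `ℓ¹`-norm on `ℤ^d`. -/
def l1 {d : ℕ} (z : Fin d → ℤ) : ℕ := ∑ i, (z i).natAbs

theorem l1_neg {d : ℕ} (z : Fin d → ℤ) : l1 (-z) = l1 z := by
  simp [l1]

/-- The nearest-neighbour graph on `ℤ^d`. -/
def lattice (d : ℕ) : SimpleGraph (Fin d → ℤ) where
  Adj x y := l1 (x - y) = 1
  symm := ⟨fun x y h => by rw [← neg_sub x y, l1_neg]; exact h⟩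
  loopless := ⟨fun x h => by simp [l1] at h⟩

/-- The set of edges of the nearest-neighbour graph on `ℤ^d`. -/
abbrev Edge (d : ℕ) : Type := (lattice d).edgeSet

/-- The sum of the edge weights along a lattice path. -/
def pathWeight {d : ℕ} (w : Edge d → ℝ) :
    {x y : Fin d → ℤ} → (lattice d).Walk x y → ℝ
  | _, _, .nil => 0
  | _, _, .cons h p => w ⟨s(_, _), h⟩ + pathWeight w p

/-- The travel time between two points: the infimum of the path weights over all paths
connecting them. -/
noncomputable def travelTime {d : ℕ} (w : Edge d → ℝ) (x y : Fin d → ℤ) : ℝ :=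
  ⨅ p : (lattice d).Walk x y, pathWeight w p

section Random

variable {d : ℕ} {Ω : Type*} [MeasurableSpace Ω]

/-- `m` is the limit in probability of `T(0, n z) / n`. -/
def IsTimeConstant (P : Measure Ω) (τ : Edge d → Ω → ℝ) (z : Fin d → ℤ) (m : ℝ) : Prop :=
  TendstoInMeasure P (fun (n : ℕ) ω => travelTime (fun e => τ e ω) 0 (n • z) / (n : ℝ))
    atTop (fun _ => m)

open Classical in
/-- The time constant: the limit in probability of `T(0, n z) / n`. For i.i.d. nonnegative weights
and `d ≥ 2` this limit exists for every `z`, so the default value is never used there. -/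
noncomputable def timeConstant (P : Measure Ω) (τ : Edge d → Ω → ℝ) (z : Fin d → ℤ) : ℝ :=
  if h : ∃ m : ℝ, IsTimeConstant P τ z m then h.choose else 0

end Random

/-- The set of sites reached by time `t`. -/
def reached {d : ℕ} (w : Edge d → ℝ) (t : ℝ) : Set (Fin d → ℤ) :=
  {z | travelTime w 0 z ≤ t}

/-- The discrete ball of radius `t` of a function `μ` on `ℤ^d`. -/
def discreteBall {d : ℕ} (μ : (Fin d → ℤ) → ℝ) (t : ℝ) : Set (Fin d → ℤ) :=
  {z | μ z ≤ t}

/-- The set of sites whose travel time from the origin deviates from `μ` by more than `ε ‖z‖`. -/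
def deviantSites {d : ℕ} (w : Edge d → ℝ) (μ : (Fin d → ℤ) → ℝ) (ε : ℝ) : Set (Fin d → ℤ) :=
  {z | ε * (l1 z : ℝ) < |travelTime w 0 z - μ z|}

/-- The set of times `t ≥ 0` at which one of the inclusions
`discreteBall μ ((1 - ε) t) ⊆ reached w t ⊆ discreteBall μ ((1 + ε) t)` fails. -/
def deviantTimes {d : ℕ} (w : Edge d → ℝ) (μ : (Fin d → ℤ) → ℝ) (ε : ℝ) : Set ℝ :=
  {t | 0 ≤ t ∧ ¬ (discreteBall μ ((1 - ε) * t) ⊆ reached w t ∧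
    reached w t ⊆ discreteBall μ ((1 + ε) * t))}

/-- The moment `E[Y ^ k]` (in `[0, ∞]`) of the minimum `Y` of `2 d` independent random variables
with law `ν`, realised as the coordinates of a product space. -/
noncomputable def momentMin (d : ℕ) (ν : Measure ℝ) (k : ℕ) : ENNReal :=
  ∫⁻ x : Fin (2 * d) → ℝ, ENNReal.ofReal ((⨅ i, x i) ^ k) ∂(Measure.pi fun _ => ν)

end FPP

/-!
The deviations are caused by isolated sites. Since `E[Y ^ d] = ∞`, the probabilities that all
edges at `z` weigh at least `M ‖z‖` have infinite sum over the sites with even nonnegative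
coordinates (`tsum_measure_Ici_eq_top`). No edge is incident to two of these sites, so the events
are independent and, by the second Borel–Cantelli lemma, almost surely infinitely many of them
occur, for every `M` (`ae_infinite_heavy_evenSite`). At such a site `T(0, z) ≥ M ‖z‖`. If `μ(z) ≤
C ‖z‖` with a constant `C`, then `z` is a deviant site as soon as `M > C + ε`, and every time
between `C ‖z‖ / (1 - ε)` and `M ‖z‖` is deviant, an interval whose length is unbounded in `z`.

It remains to bound the time constant linearly (`exists_timeConstant_le`). No moment of the
weights is finite in general, so the bound comes from tightness: it is enough that `T(0, z) ≤ C
‖z‖` with probability at least one half for every `z`, and, coordinate by coordinate, that `T(u, u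
+ n e_i)` is at most linear in `n` outside an event of small probability. This is proved in a
coordinate plane through the segment from `u` to `u + n e_i`. Call a site bad if its right or
upper edge weighs more than a large `L`; this has small probability `q`. A path along the segment
can bypass the clusters of bad sites, for `ℓ^∞`-adjacency, by walking along their boundary,
provided that these clusters do not reach the three other sides of the square based on the segment
(`detourGraph_reachable`). The planar topology needed for this is only the discrete Stokes theorem
on the square. A self-avoiding chain of `h` bad sites from a given site exists with probability at
most `(9 q) ^ h`, so the clusters reach the other sides with probability `O(q)`, and the expected
number of sites of the detour is linear in `n` (`measure_no_short_detour_le`).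
-/

namespace FPP

/-! ### Travel times -/

section TravelTime

variable {d : ℕ} {w : Edge d → ℝ}

theorem pathWeight_nonneg (hw : ∀ e, 0 ≤ w e) {x y : Fin d → ℤ} (p : (lattice d).Walk x y) :
    0 ≤ pathWeight w p := by
  induction p with
  | nil => exact le_rfl
  | cons h p ih => exact add_nonneg (hw _) ih

theorem pathWeight_append {x y z : Fin d → ℤ} (p : (lattice d).Walk x y)
    (q : (lattice d).Walk y z) :
    pathWeight w (p.append q) = pathWeight w p + pathWeight w q := by
  induction p with
  | nil => simp [pathWeight]
  | cons h p ih => simp [pathWeight, ih, add_assoc]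

theorem pathWeight_reverse {x y : Fin d → ℤ} (p : (lattice d).Walk x y) :
    pathWeight w p.reverse = pathWeight w p := by
  induction p with
  | nil => rfl
  | @cons u v y h p ih =>
    have he : (⟨s(v, u), h.symm⟩ : Edge d) = ⟨s(u, v), h⟩ := Subtype.ext Sym2.eq_swap
    rw [SimpleGraph.Walk.reverse_cons, pathWeight_append, ih]
    simp only [pathWeight, he]
    ring

theorem travelTime_le (hw : ∀ e, 0 ≤ w e) {x y : Fin d → ℤ} (p : (lattice d).Walk x y) :
    travelTime w x y ≤ pathWeight w p :=
  ciInf_le ⟨0, by rintro _ ⟨q, rfl⟩; exact pathWeight_nonneg hw q⟩ p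

theorem travelTime_self (hw : ∀ e, 0 ≤ w e) (x : Fin d → ℤ) : travelTime w x x = 0 :=
  le_antisymm (travelTime_le hw (.nil : (lattice d).Walk x x))
    (Real.iInf_nonneg fun p => pathWeight_nonneg hw p)

theorem travelTime_comm (x y : Fin d → ℤ) : travelTime w x y = travelTime w y x := by
  unfold travelTime
  refine Function.Surjective.iInf_congr (fun p => p.reverse) (fun p => ⟨p.reverse, by simp⟩)
    fun p => pathWeight_reverse p

theorem travelTime_le_edge (hw : ∀ e, 0 ≤ w e) {x y : Fin d → ℤ} (h : (lattice d).Adj x y) :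
    travelTime w x y ≤ w ⟨s(x, y), h⟩ := by
  simpa [pathWeight] using travelTime_le hw (.cons h .nil : (lattice d).Walk x y)

theorem lattice_adj_add_single (x : Fin d → ℤ) (i : Fin d) :
    (lattice d).Adj x (x + Pi.single i 1) := by
  change l1 (x - (x + Pi.single i 1)) = 1
  rw [sub_add_cancel_left, l1_neg, l1, Finset.sum_eq_single i]
  · simp
  · intro j _ hj; simp [hj]
  · simp

theorem lattice_adj_sub_single (x : Fin d → ℤ) (i : Fin d) :
    (lattice d).Adj x (x - Pi.single i 1) := by
  have h := (lattice_adj_add_single (x - Pi.single i 1) i).symm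
  rwa [sub_add_cancel] at h

theorem eq_single_of_l1_eq_one {u : Fin d → ℤ} (h : l1 u = 1) :
    ∃ i, u = Pi.single i 1 ∨ u = -Pi.single i 1 := by
  classical
  have hne : ∃ i, u i ≠ 0 := by
    by_contra! h0
    simp [l1, h0] at h
  obtain ⟨i, hi⟩ := hne
  have hsum := Finset.add_sum_erase Finset.univ (fun j => (u j).natAbs) (Finset.mem_univ i)
  change _ = l1 u at hsum
  have hz : ∑ j ∈ Finset.univ.erase i, (u j).natAbs = 0 := by omega
  have hj : ∀ j, j ≠ i → u j = 0 := fun j hj => by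
    simpa using Finset.sum_eq_zero_iff.1 hz j (by simp [hj])
  have h1 : (u i).natAbs = 1 := by omega
  refine ⟨i, (Int.natAbs_eq (u i)).imp (fun h => ?_) fun h => ?_⟩ <;>
  · ext j
    by_cases hji : j = i
    · subst hji; rw [h, h1]; simp
    · simp [hj j hji, hji]

theorem sum_single_eq (z : Fin d → ℤ) : ∑ i, z i • (Pi.single i 1 : Fin d → ℤ) = z := by
  ext j
  simp [Finset.sum_apply, Pi.single_apply]

theorem lattice_reachable_add_nsmul (x : Fin d → ℤ) (i : Fin d) (n : ℕ) :
    (lattice d).Reachable x (x + n • Pi.single i 1) := by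
  induction n with
  | zero => simp
  | succ n ih =>
    rw [succ_nsmul, ← add_assoc]
    exact ih.trans (lattice_adj_add_single _ i).reachable

theorem lattice_reachable_add_zsmul (x : Fin d → ℤ) (i : Fin d) (k : ℤ) :
    (lattice d).Reachable x (x + k • Pi.single i 1) := by
  obtain ⟨n, rfl | rfl⟩ := k.eq_nat_or_neg
  · simpa using lattice_reachable_add_nsmul x i n
  · have h := (lattice_reachable_add_nsmul (x + -(n : ℤ) • Pi.single i 1) i n).symm
    rwa [← natCast_zsmul, add_assoc, ← add_smul, neg_add_cancel, zero_smul, add_zero] at h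

theorem lattice_reachable (x y : Fin d → ℤ) : (lattice d).Reachable x y := by
  suffices h : ∀ s : Finset (Fin d),
      (lattice d).Reachable x (x + ∑ i ∈ s, (y - x) i • (Pi.single i 1 : Fin d → ℤ)) by
    have h := h Finset.univ
    rwa [sum_single_eq, add_sub_cancel] at h
  intro s
  induction s using Finset.induction_on with
  | empty => simp
  | insert i s hi ih =>
    rw [Finset.sum_insert hi, add_comm (_ • _), ← add_assoc]
    exact ih.trans (lattice_reachable_add_zsmul _ i _)

instance nonempty_lattice_walk (x y : Fin d → ℤ) : Nonempty ((lattice d).Walk x y) :=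
  lattice_reachable x y

theorem travelTime_triangle (hw : ∀ e, 0 ≤ w e) (x y z : Fin d → ℤ) :
    travelTime w x z ≤ travelTime w x y + travelTime w y z := by
  refine le_ciInf_add_ciInf fun p q => ?_
  rw [← pathWeight_append]
  exact travelTime_le hw _

/-- The last edge of any path to `z ≠ x` is incident to `z`, so `T(x, z)` is at least the smallest
weight around `z`. -/
theorem le_travelTime_of_forall_incident (hw : ∀ e, 0 ≤ w e) {x z : Fin d → ℤ} (hxz : x ≠ z)
    {t : ℝ} (ht : ∀ y (h : (lattice d).Adj z y), t ≤ w ⟨s(z, y), h⟩) :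
    t ≤ travelTime w x z := by
  rw [travelTime_comm]
  refine le_ciInf fun p => ?_
  cases p with
  | nil => exact absurd rfl hxz
  | cons h p => exact (ht _ h).trans (le_add_of_nonneg_right (pathWeight_nonneg hw p))

end TravelTime

/-! ### Paths around clusters of bad sites in the square lattice -/

section Planar

/-- The nine sites of `ℤ²` at `ℓ^∞`-distance at most one from `x`, including `x`. -/
noncomputable def starNbr (x : ℤ × ℤ) : Finset (ℤ × ℤ) :=
  Finset.Icc (x.1 - 1) (x.1 + 1) ×ˢ Finset.Icc (x.2 - 1) (x.2 + 1)

theorem mem_starNbr {x y : ℤ × ℤ} :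
    y ∈ starNbr x ↔ (x.1 - 1 ≤ y.1 ∧ y.1 ≤ x.1 + 1) ∧ x.2 - 1 ≤ y.2 ∧ y.2 ≤ x.2 + 1 := by
  simp [starNbr]

theorem mem_starNbr_comm {x y : ℤ × ℤ} : y ∈ starNbr x ↔ x ∈ starNbr y := by
  simp only [mem_starNbr]; omega

theorem card_starNbr (x : ℤ × ℤ) : (starNbr x).card = 9 := by
  have h : ∀ a : ℤ, (a + 1 + 1 - (a - 1)).toNat = 3 := fun a => by omega
  simp [starNbr, h]

/-- The `ℓ^∞`-distance on `ℤ²`. -/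
def supDist (x y : ℤ × ℤ) : ℕ := max (y.1 - x.1).natAbs (y.2 - x.2).natAbs

/-- The graph on `ℤ²` joining bad sites at `ℓ^∞`-distance one. -/
def badGraph (bad : ℤ × ℤ → Prop) : SimpleGraph (ℤ × ℤ) where
  Adj x y := x ≠ y ∧ y ∈ starNbr x ∧ bad x ∧ bad y
  symm := ⟨fun _ _ h => ⟨h.1.symm, mem_starNbr_comm.1 h.2.1, h.2.2.2, h.2.2.1⟩⟩
  loopless := ⟨fun _ h => h.1 rfl⟩

/-- The segment `{0, …, n} × {0}`. -/
noncomputable def segment (n : ℕ) : Finset (ℤ × ℤ) := Finset.Icc 0 (n : ℤ) ×ˢ {0}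

theorem mem_segment {n : ℕ} {x : ℤ × ℤ} :
    x ∈ segment n ↔ (0 ≤ x.1 ∧ x.1 ≤ n) ∧ x.2 = 0 := by
  rw [segment, Finset.mem_product, Finset.mem_Icc, Finset.mem_singleton]

/-- The union of the clusters of `badGraph bad` that contain a bad site of the segment. -/
def segmentCluster (bad : ℤ × ℤ → Prop) (n : ℕ) : Set (ℤ × ℤ) :=
  {x | bad x ∧ ∃ v ∈ segment n, (badGraph bad).Reachable v x}

/-- The sites used by the detour: those of the segment and those at `ℓ^∞`-distance at most one from
the clusters it meets, without the sites of the clusters. -/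
def detourSites (bad : ℤ × ℤ → Prop) (n : ℕ) : Set (ℤ × ℤ) :=
  {x | x ∉ segmentCluster bad n ∧ (x ∈ segment n ∨ ∃ k ∈ segmentCluster bad n, x ∈ starNbr k)}

/-- The nearest-neighbour graph on the sites of `detourSites`. -/
def detourGraph (bad : ℤ × ℤ → Prop) (n : ℕ) : SimpleGraph (ℤ × ℤ) where
  Adj x y := (x ∈ detourSites bad n ∧ y ∈ detourSites bad n) ∧
    ((y = x + (1, 0) ∨ y = x + (0, 1)) ∨ (x = y + (1, 0) ∨ x = y + (0, 1)))
  symm := ⟨fun _ _ h => ⟨h.1.symm, h.2.symm⟩⟩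
  loopless := ⟨fun x h => by
    rcases h.2 with (h | h) | (h | h) <;> simp [Prod.ext_iff] at h⟩

variable {bad : ℤ × ℤ → Prop} {n : ℕ}

theorem not_bad_of_mem_detourSites {x : ℤ × ℤ} (hx : x ∈ detourSites bad n) : ¬ bad x := by
  intro hb
  obtain ⟨hK, h | ⟨k, ⟨hk, v, hv, hvk⟩, hkx⟩⟩ := hx
  · exact hK ⟨hb, x, h, .refl _⟩
  · by_cases hne : k = x
    · exact hK (hne ▸ ⟨hk, v, hv, hvk⟩)
    · have hadj : (badGraph bad).Adj k x := ⟨hne, hkx, hk, hb⟩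
      exact hK ⟨hb, v, hv, hvk.trans hadj.reachable⟩

/-- Discrete Stokes' theorem on a rectangle: a closed 1-cochain, with values `h` on horizontal and
`v` on vertical edges, has equal sums along both ways from one corner to the opposite one. -/
theorem sum_bottom_add_sum_right_eq {h v : ℤ × ℤ → ℤ}
    (hc : ∀ x, h x + v (x + (1, 0)) = v x + h (x + (0, 1))) (n m : ℕ) :
    ∑ i ∈ Finset.range n, h ((i : ℤ), 0) + ∑ j ∈ Finset.range m, v ((n : ℤ), (j : ℤ)) =
      ∑ j ∈ Finset.range m, v (0, (j : ℤ)) + ∑ i ∈ Finset.range n, h ((i : ℤ), (m : ℤ)) := by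
  induction m with
  | zero => simp
  | succ m ih =>
    have key : ∀ n : ℕ, ∑ i ∈ Finset.range n, h ((i : ℤ), (m : ℤ)) + v ((n : ℤ), (m : ℤ)) =
        v (0, (m : ℤ)) + ∑ i ∈ Finset.range n, h ((i : ℤ), ((m + 1 : ℕ) : ℤ)) := by
      intro n
      induction n with
      | zero => simp
      | succ n ihn =>
        have := hc ((n : ℤ), (m : ℤ))
        rw [Finset.sum_range_succ, Finset.sum_range_succ]
        simp only [Prod.mk_add_mk, add_zero] at this
        push_cast at ihn this ⊢
        linarith
    rw [Finset.sum_range_succ, Finset.sum_range_succ]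
    linarith [key n]

/-- If the clusters of bad sites meeting the bottom side of a square avoid the three other sides,
then the bottom corners are joined by a path of good sites in the segment and along the clusters.
Let `A` be the indicator of the component of the left corner. The 1-cochain equal to the difference
of `A` on edges touching the clusters and to zero elsewhere is closed, since around a unit square
touching a cluster it is the difference of `A`. It vanishes on the three other sides, so it sums to
zero along the bottom side, where it is again the difference of `A`. -/
theorem detourGraph_reachable
    (hl : ∀ j : ℕ, j ≤ n → (0, (j : ℤ)) ∉ segmentCluster bad n)
    (ht : ∀ i : ℕ, i ≤ n → ((i : ℤ), (n : ℤ)) ∉ segmentCluster bad n)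
    (hr : ∀ j : ℕ, j ≤ n → ((n : ℤ), (j : ℤ)) ∉ segmentCluster bad n) :
    (detourGraph bad n).Reachable (0, 0) ((n : ℤ), 0) := by
  classical
  set K := segmentCluster bad n with hK
  set A : ℤ × ℤ → ℤ := fun x => if (detourGraph bad n).Reachable (0, 0) x then 1 else 0 with hA
  set c : ℤ × ℤ → ℤ × ℤ → ℤ := fun x y => if x ∈ K ∨ y ∈ K then A y - A x else 0 with hc
  have hadj : ∀ {x y}, (detourGraph bad n).Adj x y → A x = A y := by
    intro x y hxy
    have : (detourGraph bad n).Reachable (0, 0) x ↔ (detourGraph bad n).Reachable (0, 0) y :=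
      ⟨fun h => h.trans hxy.reachable, fun h => h.trans hxy.symm.reachable⟩
    simp only [hA, this]
  have hzero : ∀ {x y}, x ∉ K → y ∉ K → c x y = 0 := fun hx hy => by simp [hc, hx, hy]
  -- On an edge whose ends are near the clusters, the cochain is the difference of `A`.
  have hdiff : ∀ {x y}, (y = x + (1, 0) ∨ y = x + (0, 1)) →
      (x ∈ K ∨ x ∈ detourSites bad n) → (y ∈ K ∨ y ∈ detourSites bad n) → c x y = A y - A x := by
    intro x y hxy hx hy
    by_cases h : x ∈ K ∨ y ∈ K
    · simp [hc, h]
    · rw [not_or] at h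
      rw [hzero h.1 h.2, hadj ⟨⟨hx.resolve_left h.1, hy.resolve_left h.2⟩, Or.inl hxy⟩, sub_self]
  have hnear : ∀ {k x}, k ∈ K → x ∈ starNbr k → x ∈ K ∨ x ∈ detourSites bad n := by
    intro k x hk hx
    by_cases h : x ∈ K
    · exact Or.inl h
    · exact Or.inr ⟨h, Or.inr ⟨k, hk, hx⟩⟩
  have hclosed : ∀ x : ℤ × ℤ, c x (x + (1, 0)) + c (x + (1, 0)) (x + (1, 0) + (0, 1)) =
      c x (x + (0, 1)) + c (x + (0, 1)) (x + (0, 1) + (1, 0)) := by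
    intro x
    have hcomm : x + (0, 1) + (1, 0) = x + (1, 0) + (0, 1) := add_right_comm _ _ _
    rw [hcomm]
    by_cases h : ∃ k ∈ K, k = x ∨ k = x + (1, 0) ∨ k = x + (0, 1) ∨ k = x + (1, 0) + (0, 1)
    · obtain ⟨k, hk, hkx⟩ := h
      have h0 : x ∈ starNbr k := by
        rcases hkx with h | h | h | h <;> simp [mem_starNbr, h] <;> omega
      have h1 : x + (1, 0) ∈ starNbr k := by
        rcases hkx with h | h | h | h <;> simp [mem_starNbr, h] <;> omega
      have h2 : x + (0, 1) ∈ starNbr k := by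
        rcases hkx with h | h | h | h <;> simp [mem_starNbr, h] <;> omega
      have h3 : x + (1, 0) + (0, 1) ∈ starNbr k := by
        rcases hkx with h | h | h | h <;> simp [mem_starNbr, h] <;> omega
      rw [hdiff (Or.inl rfl) (hnear hk h0) (hnear hk h1),
        hdiff (Or.inr rfl) (hnear hk h1) (hnear hk h3),
        hdiff (Or.inr rfl) (hnear hk h0) (hnear hk h2),
        hdiff (Or.inl hcomm.symm) (hnear hk h2) (hnear hk h3)]
      ring
    · push Not at h
      have h0 : x ∉ K := fun hk => (h x hk).1 rfl
      have h1 : x + (1, 0) ∉ K := fun hk => (h _ hk).2.1 rfl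
      have h2 : x + (0, 1) ∉ K := fun hk => (h _ hk).2.2.1 rfl
      have h3 : x + (1, 0) + (0, 1) ∉ K := fun hk => (h _ hk).2.2.2 rfl
      rw [hzero h0 h1, hzero h1 h3, hzero h0 h2, hzero h2 h3]
  have hstokes := sum_bottom_add_sum_right_eq (h := fun x => c x (x + (1, 0)))
    (v := fun x => c x (x + (0, 1))) hclosed n n
  have hright : ∑ j ∈ Finset.range n, c ((n : ℤ), (j : ℤ)) (((n : ℤ), (j : ℤ)) + (0, 1)) = 0 :=
    Finset.sum_eq_zero fun j hj => by
      have hj := Finset.mem_range.1 hj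
      exact hzero (hr j hj.le) (by simpa using hr (j + 1) hj)
  have hleft : ∑ j ∈ Finset.range n, c (0, (j : ℤ)) ((0, (j : ℤ)) + (0, 1)) = 0 :=
    Finset.sum_eq_zero fun j hj => by
      have hj := Finset.mem_range.1 hj
      exact hzero (hl j hj.le) (by simpa using hl (j + 1) hj)
  have htop : ∑ i ∈ Finset.range n, c ((i : ℤ), (n : ℤ)) (((i : ℤ), (n : ℤ)) + (1, 0)) = 0 :=
    Finset.sum_eq_zero fun i hi => by
      have hi := Finset.mem_range.1 hi
      exact hzero (ht i hi.le) (by simpa using ht (i + 1) hi)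
  have hbottom : ∑ i ∈ Finset.range n, c ((i : ℤ), 0) (((i : ℤ), 0) + (1, 0)) =
      A ((n : ℤ), 0) - A (0, 0) := by
    rw [← Nat.cast_zero, ← Finset.sum_range_sub (fun i : ℕ => A ((i : ℤ), ((0 : ℕ) : ℤ)))]
    refine Finset.sum_congr rfl fun i hi => ?_
    have hi := Finset.mem_range.1 hi
    have hseg : ∀ i : ℕ, i ≤ n →
        ((i : ℤ), (0 : ℤ)) ∈ K ∨ ((i : ℤ), (0 : ℤ)) ∈ detourSites bad n := by
      intro i hi
      by_cases h : ((i : ℤ), (0 : ℤ)) ∈ K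
      · exact Or.inl h
      · exact Or.inr ⟨h, Or.inl (mem_segment.2 (by simp [hi]))⟩
    have := hdiff (Or.inl rfl) (hseg i hi.le) (by simpa using hseg (i + 1) hi)
    simpa using this
  have hA0 : A (0, 0) = 1 := by simp [hA]
  rw [hright, hleft, htop, hbottom, hA0] at hstokes
  by_contra hcon
  simp [hA, hcon] at hstokes

/-- The lists of `h` sites that start at `x` and move by steps of `ℓ^∞`-length at most one. -/
noncomputable def starChains : ℕ → ℤ × ℤ → Finset (List (ℤ × ℤ))
  | 0, _ => {[]}
  | h + 1, x => (starNbr x).biUnion fun y => (starChains h y).image (List.cons x)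

theorem card_starChains_le (h : ℕ) (x : ℤ × ℤ) : (starChains h x).card ≤ 9 ^ h := by
  induction h generalizing x with
  | zero => simp [starChains]
  | succ h ih =>
    refine (Finset.card_biUnion_le_card_mul _ _ (9 ^ h) fun y _ =>
      Finset.card_image_le.trans (ih y)).trans ?_
    rw [card_starNbr, pow_succ']

theorem length_of_mem_starChains {h : ℕ} {x : ℤ × ℤ} {l : List (ℤ × ℤ)}
    (hl : l ∈ starChains h x) : l.length = h := by
  induction h generalizing x l with
  | zero => simp_all [starChains]
  | succ h ih =>
    simp only [starChains, Finset.mem_biUnion, Finset.mem_image] at hl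
    obtain ⟨y, -, l', hl', rfl⟩ := hl
    simp [ih hl']

/-- There is a self-avoiding chain of `h` bad sites starting at `x`. -/
def HasBadChain (bad : ℤ × ℤ → Prop) (x : ℤ × ℤ) (h : ℕ) : Prop :=
  ∃ l ∈ starChains h x, l.Nodup ∧ ∀ y ∈ l, bad y

theorem take_support_mem_starChains {x y : ℤ × ℤ} (p : (badGraph bad).Walk x y) {h : ℕ}
    (hp : h ≤ p.length + 1) : p.support.take h ∈ starChains h x := by
  induction p generalizing h with
  | @nil u =>
    obtain _ | _ | h := h
    · simp [starChains]
    · simp only [starChains, Finset.mem_biUnion, Finset.mem_image]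
      exact ⟨u, mem_starNbr.2 (by omega), [], by simp, rfl⟩
    · simp at hp
  | @cons u v w huv p ih =>
    obtain _ | h := h
    · simp [starChains]
    · rw [SimpleGraph.Walk.support_cons, List.take_succ_cons]
      simp only [starChains, Finset.mem_biUnion, Finset.mem_image]
      exact ⟨v, huv.2.1, _, ih (by simpa using hp), rfl⟩

theorem bad_of_mem_support {x y : ℤ × ℤ} (p : (badGraph bad).Walk x y) (hx : bad x) :
    ∀ z ∈ p.support, bad z := by
  induction p with
  | nil => simpa using hx
  | cons h p ih => simpa [hx] using ih h.2.2.2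

theorem bad_left_of_reachable {x y : ℤ × ℤ} (h : (badGraph bad).Reachable x y) (hy : bad y) :
    bad x := by
  obtain ⟨p⟩ := h
  cases p with
  | nil => exact hy
  | cons h p => exact h.2.2.1

theorem supDist_le_length {x y : ℤ × ℤ} (p : (badGraph bad).Walk x y) :
    supDist x y ≤ p.length := by
  induction p with
  | nil => simp [supDist]
  | @cons u v w h p ih =>
    have := mem_starNbr.1 h.2.1
    rw [SimpleGraph.Walk.length_cons]
    simp only [supDist] at ih ⊢
    omega

theorem hasBadChain_of_reachable {x y : ℤ × ℤ} (hxy : (badGraph bad).Reachable x y) (hx : bad x)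
    {h : ℕ} (hh : h ≤ supDist x y + 1) : HasBadChain bad x h := by
  classical
  obtain ⟨p, hp⟩ := hxy.exists_isPath
  refine ⟨p.support.take h, take_support_mem_starChains p
    (hh.trans (Nat.succ_le_succ (supDist_le_length p))), hp.support_nodup.sublist
    (List.take_sublist _ _), fun z hz => bad_of_mem_support p hx z (List.mem_of_mem_take hz)⟩

/-- A bad site of a cluster that reaches down to the segment starts a chain at least as long as its
height. -/
theorem hasBadChain_of_mem_segmentCluster {x : ℤ × ℤ} (hx : x ∈ segmentCluster bad n) :
    HasBadChain bad x (x.2.natAbs + 1) := by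
  obtain ⟨hb, v, hv, hvx⟩ := hx
  refine hasBadChain_of_reachable hvx.symm hb ?_
  have := (mem_segment.1 hv).2
  simp only [supDist]
  omega

theorem exists_hasBadChain_of_mem_detourSites {x : ℤ × ℤ} (hx : x ∈ detourSites bad n) :
    ∃ v ∈ segment n, HasBadChain bad v (supDist v x) := by
  obtain ⟨-, h | ⟨k, ⟨hk, v, hv, hvk⟩, hkx⟩⟩ := hx
  · exact ⟨x, h, [], by simp [supDist, starChains], by simp, by simp⟩
  · refine ⟨v, hv, hasBadChain_of_reachable hvk (bad_left_of_reachable hvk hk) ?_⟩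
    have := mem_starNbr.1 hkx
    simp only [supDist]
    omega

theorem mem_detourSites_of_mem_support {x y : ℤ × ℤ} (p : (detourGraph bad n).Walk x y)
    (hx : x ∈ detourSites bad n) : ∀ z ∈ p.support, z ∈ detourSites bad n := by
  induction p with
  | nil => simpa using hx
  | cons h p ih => simpa [hx] using ih h.1.2

end Planar

/-! ### Length of the detour at high density of good sites -/

section Detour

variable {Ω : Type*} [MeasurableSpace Ω] {P : Measure Ω}

/-- Each `x ∈ S` contributes a factor `2 * δ`, for the choice of one of its two events. The set `F`
collects the events already chosen, so that the bound can be proved by induction on `S`. -/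
theorem measure_forall_or_inter_le {ι : Type*} {B : ι × Bool → Set Ω} {δ : ENNReal}
    (hB : ∀ F : Finset (ι × Bool), P (⋂ e ∈ F, B e) ≤ δ ^ F.card)
    (S : Finset ι) (F : Finset (ι × Bool)) (hF : ∀ e ∈ F, e.1 ∉ S) :
    P ({ω | ∀ x ∈ S, ω ∈ B (x, false) ∨ ω ∈ B (x, true)} ∩ ⋂ e ∈ F, B e) ≤
      (2 * δ) ^ S.card * δ ^ F.card := by
  classical
  induction S using Finset.induction_on generalizing F with
  | empty => simpa using hB F
  | insert a S ha ih =>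
    have hmem : ∀ b : Bool, (a, b) ∉ F := fun b hb => hF _ hb (Finset.mem_insert_self _ _)
    have hF' : ∀ b : Bool, ∀ e ∈ insert (a, b) F, e.1 ∉ S := by
      intro b e he
      rcases Finset.mem_insert.1 he with rfl | he
      · exact ha
      · exact fun h => hF e he (Finset.mem_insert_of_mem h)
    have hsub : {ω | ∀ x ∈ insert a S, ω ∈ B (x, false) ∨ ω ∈ B (x, true)} ∩ ⋂ e ∈ F, B e ⊆
        ({ω | ∀ x ∈ S, ω ∈ B (x, false) ∨ ω ∈ B (x, true)} ∩ ⋂ e ∈ insert (a, false) F, B e) ∪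
        ({ω | ∀ x ∈ S, ω ∈ B (x, false) ∨ ω ∈ B (x, true)} ∩ ⋂ e ∈ insert (a, true) F, B e) := by
      rintro ω ⟨h1, h2⟩
      have h3 : ∀ x ∈ S, ω ∈ B (x, false) ∨ ω ∈ B (x, true) :=
        fun x hx => h1 x (Finset.mem_insert_of_mem hx)
      refine (h1 a (Finset.mem_insert_self _ _)).imp (fun h => ⟨h3, ?_⟩) fun h => ⟨h3, ?_⟩ <;>
      · rw [Finset.set_biInter_insert]
        exact ⟨h, h2⟩
    refine (measure_mono hsub).trans ((measure_union_le _ _).trans ?_)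
    refine (add_le_add (ih _ (hF' false)) (ih _ (hF' true))).trans (le_of_eq ?_)
    rw [Finset.card_insert_of_notMem (hmem _), Finset.card_insert_of_notMem (hmem _),
      Finset.card_insert_of_notMem ha]
    ring

variable {bad : Ω → ℤ × ℤ → Prop} {q : ENNReal}

theorem measure_hasBadChain_le
    (hq : ∀ S : Finset (ℤ × ℤ), P {ω | ∀ x ∈ S, bad ω x} ≤ q ^ S.card) (x : ℤ × ℤ) (h : ℕ) :
    P {ω | HasBadChain (bad ω) x h} ≤ (9 * q) ^ h := by
  classical
  have hsub : {ω | HasBadChain (bad ω) x h} ⊆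
      ⋃ l ∈ (starChains h x).filter List.Nodup, {ω | ∀ y ∈ l.toFinset, bad ω y} := by
    rintro ω ⟨l, hl, hnd, hb⟩
    simp only [Set.mem_iUnion]
    exact ⟨l, Finset.mem_filter.2 ⟨hl, hnd⟩, fun y hy => hb y (List.mem_toFinset.1 hy)⟩
  calc P {ω | HasBadChain (bad ω) x h}
      ≤ ∑ l ∈ (starChains h x).filter List.Nodup, P {ω | ∀ y ∈ l.toFinset, bad ω y} :=
        (measure_mono hsub).trans (measure_biUnion_finset_le _ _)
    _ ≤ ∑ _l ∈ (starChains h x).filter List.Nodup, q ^ h := by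
        refine Finset.sum_le_sum fun l hl => (hq _).trans (le_of_eq ?_)
        obtain ⟨hl, hnd⟩ := Finset.mem_filter.1 hl
        rw [List.toFinset_card_of_nodup hnd, length_of_mem_starChains hl]
    _ ≤ (9 * q) ^ h := by
        rw [Finset.sum_const, nsmul_eq_mul, mul_pow]
        gcongr
        exact_mod_cast (Finset.card_filter_le _ _).trans (card_starChains_le h x)

theorem measurableSet_hasBadChain (hm : ∀ x, MeasurableSet {ω | bad ω x}) (x : ℤ × ℤ) (h : ℕ) :
    MeasurableSet {ω | HasBadChain (bad ω) x h} := by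
  have heq : {ω | HasBadChain (bad ω) x h} =
      ⋃ l ∈ starChains h x, ⋃ _ : l.Nodup, ⋂ y ∈ {y | y ∈ l}, {ω | bad ω y} := by
    ext ω
    simp only [HasBadChain, Set.mem_ofPred_eq, Set.mem_iUnion, Set.mem_iInter]
    exact ⟨fun ⟨l, h1, h2, h3⟩ => ⟨l, h1, h2, h3⟩, fun ⟨l, h1, h2, h3⟩ => ⟨l, h1, h2, h3⟩⟩
  rw [heq]
  exact Finset.measurableSet_biUnion _ fun l _ => MeasurableSet.iUnion fun _ =>
    MeasurableSet.biInter l.finite_toSet.countable fun y _ => hm y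

/-- The sum of `4 ^ (-‖x‖_∞)` over `ℤ²`. -/
noncomputable def supGeomSum : ENNReal := ∑' x : ℤ × ℤ, (1 / 4 : ENNReal) ^ supDist 0 x

theorem supGeomSum_ne_top : supGeomSum ≠ ⊤ := by
  have hZ : ∑' a : ℤ, (1 / 2 : ENNReal) ^ a.natAbs ≠ ⊤ := by
    have hs : Summable fun a : ℤ => (1 / 2 : NNReal) ^ a.natAbs := by
      rw [← NNReal.summable_coe]
      refine Summable.of_nat_of_neg ?_ ?_ <;>
      simpa using summable_geometric_two
    have h := ENNReal.tsum_coe_ne_top_iff_summable.2 hs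
    convert h using 3 with a
    simp [ENNReal.inv_pow]
  have hle : supGeomSum ≤ (∑' a : ℤ, (1 / 2 : ENNReal) ^ a.natAbs) *
      ∑' a : ℤ, (1 / 2 : ENNReal) ^ a.natAbs := by
    rw [← ENNReal.tsum_mul_right]
    simp_rw [← ENNReal.tsum_mul_left]
    rw [← ENNReal.tsum_prod (f := fun a b : ℤ =>
      (1 / 2 : ENNReal) ^ a.natAbs * (1 / 2 : ENNReal) ^ b.natAbs)]
    refine ENNReal.tsum_le_tsum fun x => ?_
    have h4 : (1 / 4 : ENNReal) = (1 / 2) ^ 2 := by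
      rw [one_div, one_div, ← ENNReal.inv_pow]; norm_num
    rw [h4, ← pow_mul, ← pow_add]
    refine pow_le_pow_right_of_le_one' (by simp) ?_
    simp only [supDist, Prod.fst_zero, Prod.snd_zero, sub_zero]
    omega
  exact ne_top_of_le_ne_top (ENNReal.mul_ne_top hZ hZ) hle

theorem tsum_supDist_eq (v : ℤ × ℤ) :
    ∑' x, (1 / 4 : ENNReal) ^ supDist v x = supGeomSum := by
  rw [supGeomSum, ← (Equiv.subRight v).tsum_eq fun x => (1 / 4 : ENNReal) ^ supDist 0 x]
  simp [supDist]

theorem sum_pow_succ_le {ρ : ENNReal} (hρ : ρ ≤ 1 / 4) (n : ℕ) :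
    ∑ j ∈ Finset.range n, ρ ^ (j + 1) ≤ 2 * ρ := by
  have h2 : ρ ≤ 2⁻¹ := hρ.trans (by rw [one_div]; exact ENNReal.inv_le_inv.2 (by norm_num))
  calc ∑ j ∈ Finset.range n, ρ ^ (j + 1) ≤ ∑ j ∈ Finset.range n, 2⁻¹ ^ j * ρ := by
        refine Finset.sum_le_sum fun j _ => ?_
        rw [pow_succ]
        gcongr
    _ ≤ (∑' j : ℕ, 2⁻¹ ^ j) * ρ := by
        rw [← Finset.sum_mul]
        gcongr
        exact ENNReal.sum_le_tsum _
    _ = 2 * ρ := by rw [ENNReal.tsum_geometric, ENNReal.one_sub_inv_two, inv_inv]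

/-- If sites are bad with small probability, then with probability close to one the ends of a
segment of length `n` are joined by a good path of length at most `M n`. The path has at most as
many sites as `detourSites`, whose expected number is linear in `n`; the clusters of the segment
reach the other sides of the square only through long chains of bad sites. -/
theorem measure_no_short_detour_le (hm : ∀ x, MeasurableSet {ω | bad ω x})
    (hq : ∀ S : Finset (ℤ × ℤ), P {ω | ∀ x ∈ S, bad ω x} ≤ q ^ S.card) (hq4 : 9 * q ≤ 1 / 4)
    {n : ℕ} (hn : n ≠ 0) {M : ℕ} (hM : M ≠ 0) :
    P {ω | ¬ ∃ p : (detourGraph (bad ω) n).Walk (0, 0) ((n : ℤ), 0), p.length ≤ M * n} ≤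
      6 * (9 * q) + 2 * supGeomSum / M := by
  classical
  set ρ := 9 * q with hρ
  have hchain := measure_hasBadChain_le hq
  set X : Ω → ENNReal := fun ω => ∑ v ∈ segment n, ∑' x : ℤ × ℤ,
    {ω | HasBadChain (bad ω) v (supDist v x)}.indicator 1 ω with hX
  set U₁ := ⋃ j ∈ Finset.range (n + 1), {ω | HasBadChain (bad ω) (0, (j : ℤ)) (j + 1)}
  set U₂ := ⋃ i ∈ Finset.range (n + 1), {ω | HasBadChain (bad ω) ((i : ℤ), (n : ℤ)) (n + 1)}
  set U₃ := ⋃ j ∈ Finset.range (n + 1), {ω | HasBadChain (bad ω) ((n : ℤ), (j : ℤ)) (j + 1)}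
  have hXm : Measurable X := by
    refine Finset.measurable_sum _ fun v _ => Measurable.tsum fun x => ?_
    exact measurable_one.indicator (measurableSet_hasBadChain hm _ _)
  have hsub : {ω | ¬ ∃ p : (detourGraph (bad ω) n).Walk (0, 0) ((n : ℤ), 0), p.length ≤ M * n} ⊆
      (U₁ ∪ U₂ ∪ U₃) ∪ {ω | ((M * n : ℕ) : ENNReal) ≤ X ω} := by
    intro ω hω
    by_contra hcon
    simp only [Set.mem_union, not_or, Set.mem_ofPred_eq, not_le, U₁, U₂, U₃, Set.mem_iUnion,
      Finset.mem_range, not_exists] at hcon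
    obtain ⟨⟨⟨h1, h2⟩, h3⟩, h4⟩ := hcon
    have hl : ∀ j : ℕ, j ≤ n → (0, (j : ℤ)) ∉ segmentCluster (bad ω) n := fun j hj hK =>
      h1 j (by omega) (by simpa using hasBadChain_of_mem_segmentCluster hK)
    have ht : ∀ i : ℕ, i ≤ n → ((i : ℤ), (n : ℤ)) ∉ segmentCluster (bad ω) n := fun i hi hK =>
      h2 i (by omega) (by simpa using hasBadChain_of_mem_segmentCluster hK)
    have hr : ∀ j : ℕ, j ≤ n → ((n : ℤ), (j : ℤ)) ∉ segmentCluster (bad ω) n := fun j hj hK =>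
      h3 j (by omega) (by simpa using hasBadChain_of_mem_segmentCluster hK)
    obtain ⟨p, hp⟩ := (detourGraph_reachable hl ht hr).exists_isPath
    have h0 : ((0 : ℤ), (0 : ℤ)) ∈ detourSites (bad ω) n :=
      ⟨hl 0 (zero_le), Or.inl (mem_segment.2 (by simp))⟩
    refine hω ⟨p, ?_⟩
    have hcard : (p.support.toFinset.card : ENNReal) ≤ X ω := by
      calc (p.support.toFinset.card : ENNReal) = ∑ x ∈ p.support.toFinset, 1 := by simp
        _ ≤ ∑ x ∈ p.support.toFinset, ∑ v ∈ segment n,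
            {ω | HasBadChain (bad ω) v (supDist v x)}.indicator 1 ω := by
          refine Finset.sum_le_sum fun x hx => ?_
          obtain ⟨v, hv, hvx⟩ := exists_hasBadChain_of_mem_detourSites
            (mem_detourSites_of_mem_support p h0 x (List.mem_toFinset.1 hx))
          refine le_trans (le_of_eq ?_) (Finset.single_le_sum (fun _ _ => zero_le) hv)
          rw [Set.indicator_of_mem (by exact hvx)]
          rfl
        _ ≤ X ω := by
          rw [Finset.sum_comm]
          exact Finset.sum_le_sum fun v _ => ENNReal.sum_le_tsum _
    rw [List.toFinset_card_of_nodup hp.support_nodup, SimpleGraph.Walk.length_support] at hcard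
    have := hcard.trans_lt h4
    rw [Nat.cast_lt] at this
    omega
  have hside : ∀ f : ℕ → ℤ × ℤ, P (⋃ j ∈ Finset.range (n + 1),
      {ω | HasBadChain (bad ω) (f j) (j + 1)}) ≤ 2 * ρ := fun f =>
    (measure_biUnion_finset_le _ _).trans
      ((Finset.sum_le_sum fun j _ => hchain _ _).trans (sum_pow_succ_le hq4 _))
  have hU₂ : P U₂ ≤ 2 * ρ := by
    refine (measure_biUnion_finset_le _ _).trans
      ((Finset.sum_le_sum fun i hi => (hchain _ _).trans ?_).trans (sum_pow_succ_le hq4 (n + 1)))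
    have hi := Finset.mem_range.1 hi
    exact pow_le_pow_right_of_le_one' (hq4.trans (by simp)) (by omega)
  have hEX : ∫⁻ ω, X ω ∂P ≤ (n + 1) * supGeomSum := by
    rw [hX, lintegral_finsetSum _ fun v _ => Measurable.tsum fun x =>
      measurable_one.indicator (measurableSet_hasBadChain hm _ _)]
    calc _ ≤ ∑ v ∈ segment n, supGeomSum := by
          refine Finset.sum_le_sum fun v _ => ?_
          rw [lintegral_tsum fun x =>
            (measurable_one.indicator (measurableSet_hasBadChain hm _ _)).aemeasurable,
            ← tsum_supDist_eq v]
          refine ENNReal.tsum_le_tsum fun x => ?_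
          rw [lintegral_indicator_one (measurableSet_hasBadChain hm _ _)]
          exact (hchain _ _).trans (by gcongr)
      _ = _ := by
          rw [Finset.sum_const, nsmul_eq_mul]
          congr 1
          simp [segment]
  have hMn : ((M * n : ℕ) : ENNReal) ≠ 0 := by exact_mod_cast mul_ne_zero hM hn
  have hmarkov : P {ω | ((M * n : ℕ) : ENNReal) ≤ X ω} ≤ 2 * supGeomSum / M := by
    refine (meas_ge_le_lintegral_div hXm.aemeasurable hMn (ENNReal.natCast_ne_top _)).trans ?_
    calc _ ≤ (n * (2 * supGeomSum)) / (n * M) := by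
          rw [Nat.cast_mul, mul_comm (M : ENNReal)]
          refine ENNReal.div_le_div_right (hEX.trans ?_) _
          rw [← mul_assoc, mul_two]
          gcongr
          exact_mod_cast Nat.one_le_iff_ne_zero.2 hn
      _ = _ := ENNReal.mul_div_mul_left _ _ (by exact_mod_cast hn) (ENNReal.natCast_ne_top _)
  calc _ ≤ P (U₁ ∪ U₂ ∪ U₃) + P {ω | ((M * n : ℕ) : ENNReal) ≤ X ω} :=
        (measure_mono hsub).trans (measure_union_le _ _)
    _ ≤ (2 * ρ + 2 * ρ + 2 * ρ) + 2 * supGeomSum / M := by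
        refine add_le_add ((measure_union_le _ _).trans (add_le_add
          ((measure_union_le _ _).trans (add_le_add (hside _) hU₂)) (hside _))) hmarkov
    _ = _ := by ring

end Detour

/-! ### Linear growth of travel times -/

section PlaneEmbedding

variable {d : ℕ}

/-- The embedding of `ℤ²` as the coordinate plane through `u` in the directions `i` and `j`. -/
def planeSite (u : Fin d → ℤ) (i j : Fin d) (x : ℤ × ℤ) : Fin d → ℤ :=
  u + x.1 • Pi.single i 1 + x.2 • Pi.single j 1

theorem planeSite_add_right (u : Fin d → ℤ) (i j : Fin d) (x : ℤ × ℤ) :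
    planeSite u i j (x + (1, 0)) = planeSite u i j x + Pi.single i 1 := by
  simp only [planeSite, Prod.fst_add, Prod.snd_add, add_smul, one_smul, add_zero]
  abel

theorem planeSite_add_up (u : Fin d → ℤ) (i j : Fin d) (x : ℤ × ℤ) :
    planeSite u i j (x + (0, 1)) = planeSite u i j x + Pi.single j 1 := by
  simp only [planeSite, Prod.fst_add, Prod.snd_add, add_smul, one_smul, add_zero]
  abel

/-- Each site `x` of the plane owns its right edge `(x, false)` and its upper edge `(x, true)`. -/
def planeEdge (u : Fin d → ℤ) (i j : Fin d) (x : (ℤ × ℤ) × Bool) : Edge d :=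
  ⟨s(planeSite u i j x.1, planeSite u i j x.1 + Pi.single (if x.2 then j else i) 1),
    lattice_adj_add_single _ _⟩

theorem planeSite_apply (u : Fin d → ℤ) {i j : Fin d} (hij : i ≠ j) (x : ℤ × ℤ) :
    planeSite u i j x i = u i + x.1 ∧ planeSite u i j x j = u j + x.2 := by
  simp [planeSite, hij, hij.symm]

theorem planeEdge_injective (u : Fin d → ℤ) {i j : Fin d} (hij : i ≠ j) :
    Function.Injective (planeEdge u i j) := by
  rintro ⟨x, a⟩ ⟨y, b⟩ h
  have h := congrArg Subtype.val h
  simp only [planeEdge, Sym2.eq_iff] at h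
  have hx := planeSite_apply u hij x
  have hy := planeSite_apply u hij y
  have hcoord : ∀ {f g : Fin d → ℤ}, f = g → f i = g i ∧ f j = g j := by
    rintro f _ rfl; exact ⟨rfl, rfl⟩
  rcases h with ⟨h1, h2⟩ | ⟨h1, h2⟩ <;>
  · obtain ⟨h3, h4⟩ := hcoord h1
    obtain ⟨h5, h6⟩ := hcoord h2
    cases a <;> cases b <;>
    simp [hij, hij.symm, hx, hy, Prod.ext_iff] at h3 h4 h5 h6 ⊢ <;> omega

/-- A site of the plane is bad if one of the edges it owns has weight larger than `L`. -/
def HeavySite (w : Edge d → ℝ) (u : Fin d → ℤ) (i j : Fin d) (L : ℝ) (x : ℤ × ℤ) : Prop :=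
  L < w (planeEdge u i j (x, false)) ∨ L < w (planeEdge u i j (x, true))

variable {w : Edge d → ℝ}

theorem travelTime_le_of_step (hw : ∀ e, 0 ≤ w e) {u : Fin d → ℤ} {i j : Fin d} {L : ℝ}
    {x y : ℤ × ℤ} (hx : ¬ HeavySite w u i j L x) (hxy : y = x + (1, 0) ∨ y = x + (0, 1)) :
    travelTime w (planeSite u i j x) (planeSite u i j y) ≤ L := by
  simp only [HeavySite, not_or, not_lt] at hx
  rcases hxy with rfl | rfl
  · rw [planeSite_add_right]
    exact (travelTime_le_edge hw (lattice_adj_add_single _ _)).trans hx.1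
  · rw [planeSite_add_up]
    exact (travelTime_le_edge hw (lattice_adj_add_single _ _)).trans hx.2

theorem travelTime_le_of_detour (hw : ∀ e, 0 ≤ w e) {u : Fin d → ℤ} {i j : Fin d} {L : ℝ} {n : ℕ}
    {x y : ℤ × ℤ} (p : (detourGraph (HeavySite w u i j L) n).Walk x y) :
    travelTime w (planeSite u i j x) (planeSite u i j y) ≤ L * p.length := by
  induction p with
  | nil => simp [travelTime_self hw]
  | @cons x y z h p ih =>
    have hxy : travelTime w (planeSite u i j x) (planeSite u i j y) ≤ L := by
      rcases h.2 with h' | h'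
      · exact travelTime_le_of_step hw (not_bad_of_mem_detourSites h.1.1) h'
      · rw [travelTime_comm]
        exact travelTime_le_of_step hw (not_bad_of_mem_detourSites h.1.2) h'
    rw [SimpleGraph.Walk.length_cons]
    push_cast
    linarith [travelTime_triangle hw (planeSite u i j x) (planeSite u i j y) (planeSite u i j z)]

end PlaneEmbedding

section LinearGrowth

theorem exists_measure_Ioi_le (ν : Measure ℝ) [IsFiniteMeasure ν] {δ : ENNReal} (hδ : δ ≠ 0) :
    ∃ L : ℝ, 0 ≤ L ∧ ν (Set.Ioi L) ≤ δ := by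
  have h : Tendsto (fun n : ℕ => ν (Set.Ioi (n : ℝ))) atTop (nhds (ν (⋂ n : ℕ, Set.Ioi (n : ℝ)))) :=
    tendsto_measure_iInter_atTop (fun n => measurableSet_Ioi.nullMeasurableSet)
      (fun m n hmn => Set.Ioi_subset_Ioi (by exact_mod_cast hmn)) ⟨0, measure_ne_top _ _⟩
  have hempty : ⋂ n : ℕ, Set.Ioi (n : ℝ) = ∅ := by
    refine Set.eq_empty_of_forall_notMem fun x hx => ?_
    obtain ⟨n, hn⟩ := exists_nat_gt x
    exact lt_asymm hn (Set.mem_iInter.1 hx n)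
  rw [hempty, measure_empty] at h
  obtain ⟨n, hn⟩ := (h.eventually (gt_mem_nhds hδ.bot_lt)).exists
  exact ⟨n, n.cast_nonneg, hn.le⟩

variable {d : ℕ} {Ω : Type*} [MeasurableSpace Ω] {P : Measure Ω} {τ : Edge d → Ω → ℝ}
  {ν : Measure ℝ}

theorem measure_biInter_preimage_eq (hmeas : ∀ e, Measurable (τ e)) (hindep : iIndepFun τ P)
    (hlaw : ∀ e, P.map (τ e) = ν) (F : Finset (Edge d)) {s : Edge d → Set ℝ}
    (hs : ∀ e, MeasurableSet (s e)) :
    P (⋂ e ∈ F, τ e ⁻¹' s e) = ∏ e ∈ F, ν (s e) := by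
  rw [hindep.measure_inter_preimage_eq_mul F fun e _ => hs e]
  refine Finset.prod_congr rfl fun e _ => ?_
  rw [← hlaw e, Measure.map_apply (hmeas e) (hs e)]

/-- Without any moment assumption, `T(u, u + n e_i)` is at most linear in `n`, up to an event of
small probability uniform in `n`. -/
theorem exists_measure_travelTime_axis_le (hd : 2 ≤ d) [IsProbabilityMeasure ν]
    (hmeas : ∀ e, Measurable (τ e)) (hnonneg : ∀ e ω, 0 ≤ τ e ω) (hindep : iIndepFun τ P)
    (hlaw : ∀ e, P.map (τ e) = ν) {η : ENNReal} (hη : η ≠ 0) :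
    ∃ C : ℝ, 0 ≤ C ∧ ∀ (u : Fin d → ℤ) (i : Fin d) (n : ℕ),
      P {ω | C * n < travelTime (fun e => τ e ω) u (u + n • Pi.single i 1)} ≤ η := by
  classical
  -- Half of `η` pays for the long chains (`6 * (9 * q) ≤ η / 2` with `q = 2 * δ`), half for Markov.
  set δ : ENNReal := min (1 / 72) (η / 216) with hδ
  have hδ0 : δ ≠ 0 := by
    rw [hδ, ← pos_iff_ne_zero, lt_min_iff]
    exact ⟨by simp, ENNReal.div_pos hη (by simp)⟩
  obtain ⟨L, hL, hνL⟩ := exists_measure_Ioi_le ν hδ0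
  have hfin : 4 * supGeomSum / η ≠ ⊤ :=
    ENNReal.div_ne_top (ENNReal.mul_ne_top (by simp) supGeomSum_ne_top) hη
  obtain ⟨M, hM⟩ := ENNReal.exists_nat_gt hfin
  have hM0 : M ≠ 0 := by rintro rfl; simp at hM
  refine ⟨L * M, by positivity, fun u i n => ?_⟩
  obtain rfl | hn := eq_or_ne n 0
  · simp [travelTime_self (hnonneg · _)]
  have : Nontrivial (Fin d) := Fin.nontrivial_iff_two_le.2 hd
  obtain ⟨j, hj⟩ := exists_ne i
  have hB : ∀ F : Finset ((ℤ × ℤ) × Bool),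
      P (⋂ x ∈ F, τ (planeEdge u i j x) ⁻¹' Set.Ioi L) ≤ δ ^ F.card := by
    intro F
    have := measure_biInter_preimage_eq hmeas hindep hlaw (F.image (planeEdge u i j))
      (s := fun _ => Set.Ioi L) fun _ => measurableSet_Ioi
    rw [Finset.set_biInter_finset_image, Finset.prod_const,
      Finset.card_image_of_injective _ (planeEdge_injective u hj.symm)] at this
    rw [this]
    gcongr
  have hq : ∀ S : Finset (ℤ × ℤ),
      P {ω | ∀ x ∈ S, HeavySite (fun e => τ e ω) u i j L x} ≤ (2 * δ) ^ S.card := by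
    intro S
    simpa [HeavySite] using measure_forall_or_inter_le hB S ∅ (by simp)
  have hm : ∀ x, MeasurableSet {ω | HeavySite (fun e => τ e ω) u i j L x} := fun x =>
    (measurableSet_lt measurable_const (hmeas _)).union
      (measurableSet_lt measurable_const (hmeas _))
  have hq4 : 9 * (2 * δ) ≤ 1 / 4 := by
    calc 9 * (2 * δ) ≤ 9 * (2 * (1 / 72)) := by gcongr; exact min_le_left _ _
      _ = 1 / 4 := by
        rw [← mul_assoc, ← mul_div_assoc, mul_one,
          ENNReal.div_eq_div_iff (by simp) (by simp) (by simp) (by simp)]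
        norm_num
  have hsub : {ω | L * M * n < travelTime (fun e => τ e ω) u (u + n • Pi.single i 1)} ⊆
      {ω | ¬ ∃ p : (detourGraph (HeavySite (fun e => τ e ω) u i j L) n).Walk (0, 0) ((n : ℤ), 0),
        p.length ≤ M * n} := by
    rintro ω hω ⟨p, hp⟩
    have h := travelTime_le_of_detour (hnonneg · ω) p
    have h0 : planeSite u i j (0, 0) = u := by simp [planeSite]
    have h1 : planeSite u i j ((n : ℤ), 0) = u + n • Pi.single i 1 := by
      simp only [planeSite, zero_smul, add_zero, natCast_zsmul]
    rw [h0, h1] at h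
    refine absurd (h.trans ?_) (not_le.2 hω)
    rw [mul_assoc]
    exact mul_le_mul_of_nonneg_left (by exact_mod_cast hp) hL
  refine (measure_mono hsub).trans ((measure_no_short_detour_le hm hq hq4 hn hM0).trans ?_)
  have h1 : 6 * (9 * (2 * δ)) ≤ η / 2 := by
    calc 6 * (9 * (2 * δ)) ≤ 6 * (9 * (2 * (η / 216))) := by gcongr; exact min_le_right _ _
      _ = (108 * η) / (108 * 2) := by
        rw [← mul_div_assoc, ← mul_div_assoc, ← mul_div_assoc, ← mul_assoc, ← mul_assoc]
        norm_num
      _ = η / 2 := ENNReal.mul_div_mul_left _ _ (by simp) (by simp)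
  have h2 : 2 * supGeomSum / M ≤ η / 2 := by
    have hM' := hM.le
    rw [ENNReal.div_le_iff_le_mul (Or.inl hη)
      (Or.inr (Nat.cast_ne_zero.2 hM0))] at hM'
    refine ENNReal.div_le_of_le_mul ?_
    have h4 : 2 * supGeomSum = (4 * supGeomSum) / 2 := by
      rw [show (4 : ENNReal) = 2 * 2 by norm_num, mul_assoc, mul_div_assoc, mul_comm 2 (_ / _),
        ENNReal.div_mul_cancel (by simp) (by simp)]
    rw [h4]
    refine (ENNReal.div_le_div_right hM' 2).trans (le_of_eq ?_)
    rw [div_eq_mul_inv, div_eq_mul_inv]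
    ring
  calc _ ≤ η / 2 + η / 2 := add_le_add h1 h2
    _ = η := ENNReal.add_halves η

/-- With probability at least one half, `T(0, z) ≤ C ‖z‖`: reach `z` by adjusting one coordinate
after the other. -/
theorem exists_measure_travelTime_le (hd : 2 ≤ d) [IsProbabilityMeasure ν]
    (hmeas : ∀ e, Measurable (τ e)) (hnonneg : ∀ e ω, 0 ≤ τ e ω) (hindep : iIndepFun τ P)
    (hlaw : ∀ e, P.map (τ e) = ν) :
    ∃ C : ℝ, 0 ≤ C ∧ ∀ z : Fin d → ℤ,
      P {ω | C * l1 z < travelTime (fun e => τ e ω) 0 z} ≤ 1 / 2 := by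
  classical
  have hη : (1 / 2 / d : ENNReal) ≠ 0 := by simp
  obtain ⟨C, hC, hCP⟩ := exists_measure_travelTime_axis_le hd hmeas hnonneg hindep hlaw hη
  refine ⟨C, hC, fun z => ?_⟩
  have hz : ∀ (u : Fin d → ℤ) (i : Fin d) (k : ℤ),
      P {ω | C * k.natAbs < travelTime (fun e => τ e ω) u (u + k • Pi.single i 1)} ≤
        1 / 2 / d := by
    intro u i k
    obtain ⟨n, rfl | rfl⟩ := k.eq_nat_or_neg
    · simpa only [Int.natAbs_natCast, natCast_zsmul] using hCP u i n
    · have h := hCP (u + -(n : ℤ) • Pi.single i 1) i n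
      rw [← natCast_zsmul, add_assoc, ← add_smul, neg_add_cancel, zero_smul, add_zero] at h
      simp_rw [travelTime_comm u]
      simpa only [Int.natAbs_neg, Int.natAbs_natCast] using h
  have hsum : ∀ s : Finset (Fin d),
      P {ω | C * ∑ i ∈ s, ((z i).natAbs : ℝ) <
        travelTime (fun e => τ e ω) 0 (∑ i ∈ s, z i • Pi.single i 1)} ≤
          s.card * (1 / 2 / d) := by
    intro s
    induction s using Finset.induction_on with
    | empty => simp [travelTime_self (hnonneg · _)]
    | insert i s hi ih =>
      set y : Fin d → ℤ := ∑ i ∈ s, z i • Pi.single i 1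
      have hsub : {ω | C * ∑ i ∈ insert i s, ((z i).natAbs : ℝ) <
            travelTime (fun e => τ e ω) 0 (∑ i ∈ insert i s, z i • Pi.single i 1)} ⊆
          {ω | C * ∑ i ∈ s, ((z i).natAbs : ℝ) < travelTime (fun e => τ e ω) 0 y} ∪
          {ω | C * (z i).natAbs <
            travelTime (fun e => τ e ω) y (y + z i • Pi.single i 1)} := by
        intro ω hω
        by_contra hcon
        simp only [Set.mem_union, Set.mem_ofPred_eq, not_or, not_lt] at hcon
        rw [Set.mem_ofPred_eq, Finset.sum_insert hi, Finset.sum_insert hi,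
          add_comm (z i • _)] at hω
        have := travelTime_triangle (hnonneg · ω) 0 y (y + z i • Pi.single i 1)
        rw [mul_add] at hω
        linarith [hcon.1, hcon.2]
      refine (measure_mono hsub).trans ((measure_union_le _ _).trans
        ((add_le_add ih (hz y i (z i))).trans (le_of_eq ?_)))
      rw [Finset.card_insert_of_notMem hi]
      push_cast
      ring
  have h := hsum Finset.univ
  rw [sum_single_eq, Finset.card_univ, Fintype.card_fin,
    ENNReal.mul_div_cancel (by simp; omega) (ENNReal.natCast_ne_top d)] at h
  simpa [l1] using h

/-- Any limit in probability of `T(0, n z) / n` is at most linear in `z`; the default value of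
`timeConstant` obeys the same bound, so the existence of the limit plays no role. -/
theorem exists_timeConstant_le (hd : 2 ≤ d) [IsProbabilityMeasure P] [IsProbabilityMeasure ν]
    (hmeas : ∀ e, Measurable (τ e)) (hnonneg : ∀ e ω, 0 ≤ τ e ω) (hindep : iIndepFun τ P)
    (hlaw : ∀ e, P.map (τ e) = ν) :
    ∃ C : ℝ, 0 ≤ C ∧ ∀ z : Fin d → ℤ, timeConstant P τ z ≤ C * l1 z := by
  obtain ⟨C, hC, hCP⟩ := exists_measure_travelTime_le hd hmeas hnonneg hindep hlaw
  refine ⟨C, hC, fun z => ?_⟩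
  suffices h : ∀ m, IsTimeConstant P τ z m → m ≤ C * l1 z by
    unfold timeConstant
    split_ifs with hex
    · exact h _ hex.choose_spec
    · positivity
  intro m hm
  by_contra! hlt
  have hlim := hm (ENNReal.ofReal (m - C * l1 z)) (by simpa using hlt)
  obtain ⟨n, hn, hn0⟩ := ((hlim.eventually (gt_mem_nhds (show (0 : ENNReal) < 1 / 2 by simp))).and
    (eventually_gt_atTop 0)).exists
  have hl1 : (l1 (n • z) : ℝ) = n * l1 z := by
    simp [l1, Int.natAbs_mul, Finset.mul_sum]
  have hcover : (Set.univ : Set Ω) ⊆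
      {ω | C * l1 (n • z) < travelTime (fun e => τ e ω) 0 (n • z)} ∪
      {ω | ENNReal.ofReal (m - C * l1 z) ≤
        edist (travelTime (fun e => τ e ω) 0 (n • z) / (n : ℝ)) m} := by
    intro ω _
    by_cases h : C * l1 (n • z) < travelTime (fun e => τ e ω) 0 (n • z)
    · exact Or.inl h
    · refine Or.inr ?_
      rw [Set.mem_ofPred_eq, edist_comm, edist_dist, Real.dist_eq]
      refine ENNReal.ofReal_le_ofReal (le_trans ?_ (le_abs_self _))
      have hn0' : (0 : ℝ) < n := by exact_mod_cast hn0
      have : travelTime (fun e => τ e ω) 0 (n • z) / (n : ℝ) ≤ C * l1 z := by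
        rw [div_le_iff₀ hn0']
        rw [not_lt, hl1] at h
        linarith
      linarith
  have hone : (1 : ENNReal) < 1 := by
    calc (1 : ENNReal) = P Set.univ := measure_univ.symm
      _ ≤ _ := (measure_mono hcover).trans (measure_union_le _ _)
      _ < 1 / 2 + 1 / 2 := ENNReal.add_lt_add_of_le_of_lt
          (ne_top_of_le_ne_top (by simp) (hCP (n • z))) (hCP (n • z)) hn
      _ = 1 := ENNReal.add_halves 1
  exact lt_irrefl _ hone

end LinearGrowth

/-! ### Isolated sites -/

section Isolated

variable {d : ℕ}

/-- The edges incident to `z`. -/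
noncomputable def incidentEdges (z : Fin d → ℤ) : Finset (Edge d) := by
  classical exact Finset.univ.image fun a : Fin d × Bool =>
    if a.2 then ⟨s(z, z + Pi.single a.1 1), lattice_adj_add_single z a.1⟩
    else ⟨s(z, z - Pi.single a.1 1), lattice_adj_sub_single z a.1⟩

theorem card_incidentEdges_le (z : Fin d → ℤ) : (incidentEdges z).card ≤ 2 * d := by
  refine Finset.card_image_le.trans (le_of_eq ?_)
  simp [mul_comm]

theorem mem_incidentEdges {z y : Fin d → ℤ} (h : (lattice d).Adj z y) :
    (⟨s(z, y), h⟩ : Edge d) ∈ incidentEdges z := by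
  classical
  obtain ⟨i, hi | hi⟩ := eq_single_of_l1_eq_one (show l1 (y - z) = 1 from h.symm)
  · obtain rfl : y = z + Pi.single i 1 := by rw [← hi]; abel
    exact Finset.mem_image.2 ⟨(i, true), Finset.mem_univ _, rfl⟩
  · obtain rfl : y = z - Pi.single i 1 := by rw [sub_eq_add_neg, ← hi]; abel
    exact Finset.mem_image.2 ⟨(i, false), Finset.mem_univ _, rfl⟩

theorem exists_eq_of_mem_incidentEdges {z : Fin d → ℤ} {e : Edge d} (he : e ∈ incidentEdges z) :
    ∃ y, (lattice d).Adj z y ∧ e.1 = s(z, y) := by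
  classical
  obtain ⟨⟨i, b⟩, -, rfl⟩ := Finset.mem_image.1 he
  cases b
  · exact ⟨z - Pi.single i 1, lattice_adj_sub_single z i, rfl⟩
  · exact ⟨z + Pi.single i 1, lattice_adj_add_single z i, rfl⟩

/-- The sites with even nonnegative coordinates, no two of which are adjacent. -/
def evenSite (v : Fin d → ℕ) : Fin d → ℤ := fun i => 2 * (v i : ℤ)

theorem evenSite_injective : Function.Injective (evenSite (d := d)) := by
  intro v v' h
  ext i
  have := congrFun h i
  simp only [evenSite] at this
  omega

theorem l1_evenSite_le (v : Fin d → ℕ) : l1 (evenSite v) ≤ 2 * d * Finset.univ.sup v := by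
  calc l1 (evenSite v) ≤ ∑ _i : Fin d, 2 * Finset.univ.sup v := by
        refine Finset.sum_le_sum fun i hi => ?_
        have := Finset.le_sup (f := v) hi
        simp only [evenSite]
        omega
    _ = _ := by simp; ring

theorem not_adj_evenSite (v v' : Fin d → ℕ) : ¬ (lattice d).Adj (evenSite v) (evenSite v') := by
  intro h
  have h : l1 (evenSite v - evenSite v') = 1 := h
  obtain ⟨i, hi⟩ := eq_single_of_l1_eq_one h
  have h1 : (evenSite v - evenSite v') i = 1 ∨ (evenSite v - evenSite v') i = -1 := by
    rcases hi with h | h <;> rw [h] <;> simp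
  simp only [evenSite, Pi.sub_apply] at h1
  omega

theorem pairwise_disjoint_incidentEdges :
    Pairwise fun v v' : Fin d → ℕ =>
      Disjoint (incidentEdges (evenSite v)) (incidentEdges (evenSite v')) := by
  intro v v' hne
  refine Finset.disjoint_left.2 fun e he he' => ?_
  obtain ⟨y, hy, hey⟩ := exists_eq_of_mem_incidentEdges he
  obtain ⟨y', -, hey'⟩ := exists_eq_of_mem_incidentEdges he'
  rw [hey, Sym2.eq_iff] at hey'
  rcases hey' with ⟨h, -⟩ | ⟨-, h⟩
  · exact hne (evenSite_injective h)
  · exact not_adj_evenSite v v' (h ▸ hy)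

theorem measure_pi_le_iInf (hd : 0 < d) (ν : Measure ℝ) [IsProbabilityMeasure ν] (t : ℝ) :
    (Measure.pi fun _ : Fin (2 * d) => ν) {x | t ≤ ⨅ i, x i} = ν (Set.Ici t) ^ (2 * d) := by
  have : Nonempty (Fin (2 * d)) := ⟨⟨0, by omega⟩⟩
  have heq : {x : Fin (2 * d) → ℝ | t ≤ ⨅ i, x i} = Set.univ.pi fun _ => Set.Ici t := by
    ext x
    simp [le_ciInf_iff (Set.finite_range x).bddBelow, Pi.le_def]
  rw [heq, Measure.pi_pi]
  simp

/-- A cube of side `⌊y / a⌋ + 1` contains at least `(y / a) ^ d` sites. -/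
theorem ofReal_pow_le_tsum (d : ℕ) {a y : ℝ} (ha : 0 < a) (hy : 0 ≤ y) :
    ENNReal.ofReal (y ^ d) ≤ ENNReal.ofReal (a ^ d) *
      ∑' v : Fin d → ℕ, {y : ℝ | a * (Finset.univ.sup v : ℕ) ≤ y}.indicator 1 y := by
  classical
  set k := ⌊y / a⌋₊
  have hk : y ≤ a * (k + 1 : ℕ) := by
    have := (Nat.lt_floor_add_one (y / a)).le
    rw [div_le_iff₀ ha] at this
    push_cast
    linarith
  have hka : a * k ≤ y := by
    have := Nat.floor_le (div_nonneg hy ha.le)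
    rw [le_div_iff₀ ha] at this
    linarith
  have hcube : (((k + 1) ^ d : ℕ) : ENNReal) ≤
      ∑' v : Fin d → ℕ, {y : ℝ | a * (Finset.univ.sup v : ℕ) ≤ y}.indicator 1 y := by
    calc (((k + 1) ^ d : ℕ) : ENNReal)
        = ∑ _v ∈ Fintype.piFinset fun _ : Fin d => Finset.range (k + 1), 1 := by simp
      _ ≤ ∑ v ∈ Fintype.piFinset fun _ : Fin d => Finset.range (k + 1),
          {y : ℝ | a * (Finset.univ.sup v : ℕ) ≤ y}.indicator 1 y := by
        refine Finset.sum_le_sum fun v hv => ?_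
        have hsup : Finset.univ.sup v ≤ k := Finset.sup_le fun i _ => by
          have := Finset.mem_range.1 (Fintype.mem_piFinset.1 hv i)
          omega
        have hmem : y ∈ {y : ℝ | a * (Finset.univ.sup v : ℕ) ≤ y} := by
          refine le_trans ?_ hka
          have : ((Finset.univ.sup v : ℕ) : ℝ) ≤ k := by exact_mod_cast hsup
          gcongr
        rw [Set.indicator_of_mem hmem]
        rfl
      _ ≤ _ := ENNReal.sum_le_tsum _
  calc ENNReal.ofReal (y ^ d) ≤ ENNReal.ofReal ((a * (k + 1 : ℕ)) ^ d) :=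
        ENNReal.ofReal_le_ofReal (pow_le_pow_left₀ hy hk d)
    _ = ENNReal.ofReal (a ^ d) * (((k + 1) ^ d : ℕ) : ENNReal) := by
        rw [mul_pow, ENNReal.ofReal_mul (by positivity), ← Nat.cast_pow, ENNReal.ofReal_natCast]
    _ ≤ _ := by gcongr

/-- If `E[Y ^ d] = ∞`, then the probabilities `P(Y ≥ a ‖v‖_∞)` have infinite sum over `ℕ^d`. -/
theorem tsum_measure_Ici_eq_top (hd : 0 < d) {ν : Measure ℝ} [IsProbabilityMeasure ν]
    (hν : ∀ᵐ x ∂ν, 0 ≤ x) (hY : momentMin d ν d = ⊤) {a : ℝ} (ha : 0 < a) :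
    ∑' v : Fin d → ℕ, ν (Set.Ici (a * (Finset.univ.sup v : ℕ))) ^ (2 * d) = ⊤ := by
  have : Nonempty (Fin (2 * d)) := ⟨⟨0, by omega⟩⟩
  set π := Measure.pi fun _ : Fin (2 * d) => ν
  have hπ : ∀ᵐ x ∂π, 0 ≤ ⨅ i, x i := by
    have h : ∀ i : Fin (2 * d), ∀ᵐ x ∂π, 0 ≤ x i := fun i =>
      Measure.tendsto_eval_ae_ae.eventually hν
    filter_upwards [eventually_all.2 h] with x hx using Real.iInf_nonneg hx
  have hm : ∀ t : ℝ, MeasurableSet {x : Fin (2 * d) → ℝ | t ≤ ⨅ i, x i} := fun t =>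
    measurableSet_le measurable_const (Measurable.iInf fun i => measurable_pi_apply i)
  have hle : momentMin d ν d ≤ ENNReal.ofReal (a ^ d) *
      ∑' v : Fin d → ℕ, ν (Set.Ici (a * (Finset.univ.sup v : ℕ))) ^ (2 * d) := by
    calc momentMin d ν d ≤ ∫⁻ x, ENNReal.ofReal (a ^ d) * ∑' v : Fin d → ℕ,
          {x : Fin (2 * d) → ℝ | a * (Finset.univ.sup v : ℕ) ≤ ⨅ i, x i}.indicator 1 x ∂π := by
          refine lintegral_mono_ae ?_
          filter_upwards [hπ] with x hx using ofReal_pow_le_tsum d ha hx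
      _ = _ := by
          rw [lintegral_const_mul _ (Measurable.tsum fun v =>
            measurable_one.indicator (hm _)), lintegral_tsum fun v =>
            (measurable_one.indicator (hm _)).aemeasurable]
          congr 1
          refine tsum_congr fun v => ?_
          rw [lintegral_indicator_one (hm _), measure_pi_le_iInf hd]
  by_contra hne
  rw [hY, top_le_iff] at hle
  exact ENNReal.mul_ne_top ENNReal.ofReal_ne_top hne hle

variable {Ω : Type*} [MeasurableSpace Ω] {P : Measure Ω} {τ : Edge d → Ω → ℝ} {ν : Measure ℝ}

/-- Almost surely, infinitely many sites `z` have all incident weights at least `M ‖z‖`: these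
events are independent along `evenSite`, and their probabilities have infinite sum. -/
theorem ae_infinite_heavy_evenSite (hd : 0 < d) [IsProbabilityMeasure P] [IsProbabilityMeasure ν]
    (hmeas : ∀ e, Measurable (τ e)) (hnonneg : ∀ e ω, 0 ≤ τ e ω) (hindep : iIndepFun τ P)
    (hlaw : ∀ e, P.map (τ e) = ν) (hY : momentMin d ν d = ⊤) {M : ℝ} (hM : 0 < M) :
    ∀ᵐ ω ∂P, {v : Fin d → ℕ | ∀ e ∈ incidentEdges (evenSite v),
      M * l1 (evenSite v) ≤ τ e ω}.Infinite := by
  classical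
  have : Infinite (Fin d → ℕ) := by
    have : Nonempty (Fin d) := ⟨⟨0, hd⟩⟩
    infer_instance
  let φ : ℕ ≃ (Fin d → ℕ) := (nonempty_denumerable (Fin d → ℕ)).some.eqv.symm
  set s : (Fin d → ℕ) → Set Ω := fun v =>
    ⋂ e ∈ incidentEdges (evenSite v), τ e ⁻¹' Set.Ici (M * l1 (evenSite v)) with hs
  have hsm : ∀ v, MeasurableSet (s v) := fun v =>
    Finset.measurableSet_biInter _ fun e _ => hmeas e measurableSet_Ici
  have hsP : ∀ v, P (s v) =
      ν (Set.Ici (M * l1 (evenSite v))) ^ (incidentEdges (evenSite v)).card := by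
    intro v
    rw [hs, hindep.measure_inter_preimage_eq_mul _ fun e _ => measurableSet_Ici,
      ← Finset.prod_const]
    refine Finset.prod_congr rfl fun e _ => ?_
    rw [← hlaw e, Measure.map_apply (hmeas e) measurableSet_Ici]
  have hν : ∀ᵐ x ∂ν, 0 ≤ x := by
    let z : Fin d → ℤ := 0
    let e : Edge d := ⟨s(z, z + Pi.single ⟨0, hd⟩ 1), lattice_adj_add_single _ _⟩
    rw [← hlaw e, ae_map_iff (hmeas e).aemeasurable measurableSet_Ici]
    exact ae_of_all _ (hnonneg e)
  have hsind : iIndepSet (fun n => s (φ n)) P := by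
    rw [iIndepSet_iff_meas_biInter fun n => hsm _]
    intro F
    have hdisj : ∀ n, ∀ e ∈ incidentEdges (evenSite (φ n)), ∀ n',
        e ∈ incidentEdges (evenSite (φ n')) → n' = n := by
      intro n e he n' he'
      by_contra hne
      exact Finset.disjoint_left.1
        (pairwise_disjoint_incidentEdges fun h => hne (φ.injective h)) he' he
    -- On the union of the stars each edge determines its star, hence its threshold.
    let t : Edge d → Set ℝ := fun e =>
      ⋂ n ∈ {n | e ∈ incidentEdges (evenSite (φ n))}, Set.Ici (M * l1 (evenSite (φ n)))
    have ht : ∀ n, ∀ e ∈ incidentEdges (evenSite (φ n)),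
        t e = Set.Ici (M * l1 (evenSite (φ n))) := by
      intro n e he
      have : {n | e ∈ incidentEdges (evenSite (φ n))} = {n} :=
        Set.eq_singleton_iff_unique_mem.2 ⟨he, fun n' he' => hdisj n e he n' he'⟩
      simp only [t, this, Set.biInter_singleton]
    have htm : ∀ e, MeasurableSet (t e) := fun e =>
      MeasurableSet.biInter (Set.to_countable _) fun _ _ => measurableSet_Ici
    have hst : ∀ n, s (φ n) = ⋂ e ∈ incidentEdges (evenSite (φ n)), τ e ⁻¹' t e := by
      intro n
      simp only [hs]
      exact Set.iInter₂_congr fun e he => by rw [ht n e he]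
    simp_rw [hst]
    rw [← Finset.set_biInter_biUnion, hindep.measure_inter_preimage_eq_mul _ fun e _ => htm e,
      Finset.prod_biUnion]
    · exact Finset.prod_congr rfl fun n _ =>
        (hindep.measure_inter_preimage_eq_mul _ fun e _ => htm e).symm
    · exact fun n _ n' _ hne => pairwise_disjoint_incidentEdges fun h => hne (φ.injective h)
  have hsum : ∑' n, P (s (φ n)) = ⊤ := by
    rw [φ.tsum_eq fun v => P (s v), ← top_le_iff,
      ← tsum_measure_Ici_eq_top hd hν hY (a := M * (2 * d)) (by positivity)]
    refine ENNReal.tsum_le_tsum fun v => ?_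
    rw [hsP]
    calc ν (Set.Ici (M * (2 * d) * (Finset.univ.sup v : ℕ))) ^ (2 * d)
        ≤ ν (Set.Ici (M * l1 (evenSite v))) ^ (2 * d) := by
          have : (l1 (evenSite v) : ℝ) ≤ 2 * d * (Finset.univ.sup v : ℕ) := by
            exact_mod_cast l1_evenSite_le v
          rw [mul_assoc]
          gcongr
      _ ≤ _ := pow_le_pow_right_of_le_one' prob_le_one (card_incidentEdges_le _)
  have hlimsup := measure_limsup_eq_one (fun n => hsm (φ n)) hsind hsum
  have hlm : MeasurableSet (limsup (fun n => s (φ n)) atTop) :=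
    MeasurableSet.measurableSet_limsup fun n => hsm (φ n)
  have hae := (prob_compl_eq_zero_iff hlm).2 hlimsup
  filter_upwards [measure_eq_zero_iff_ae_notMem.1 hae] with ω hω
  rw [Set.notMem_compl_iff, mem_limsup_iff_frequently_mem, Nat.frequently_atTop_iff_infinite] at hω
  refine (hω.image φ.injective.injOn).mono ?_
  rintro _ ⟨n, hn, rfl⟩
  simpa [hs] using hn

end Isolated

/-! ### Deviations caused by isolated sites -/

section Deviation

variable {d : ℕ} {w : Edge d → ℝ} {μ : (Fin d → ℤ) → ℝ} {C M ε : ℝ}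

theorem le_travelTime_of_incidentEdges (hw : ∀ e, 0 ≤ w e) {v : Fin d → ℕ} {t : ℝ} (hv : v ≠ 0)
    (h : ∀ e ∈ incidentEdges (evenSite v), t ≤ w e) : t ≤ travelTime w 0 (evenSite v) := by
  refine le_travelTime_of_forall_incident hw (fun h0 => hv ?_) fun y hy =>
    h _ (mem_incidentEdges hy)
  exact evenSite_injective (h0.symm.trans (by ext; simp [evenSite]))

theorem le_l1_evenSite (v : Fin d → ℕ) (i : Fin d) : v i ≤ l1 (evenSite v) := by
  refine le_trans ?_ (Finset.single_le_sum (f := fun i => (evenSite v i).natAbs)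
    (fun _ _ => Nat.zero_le _) (Finset.mem_univ i))
  simp only [evenSite]
  omega

theorem infinite_deviantSites (hw : ∀ e, 0 ≤ w e) (hμ : ∀ z, μ z ≤ C * l1 z) (hM : C + ε < M)
    (hinf : {v : Fin d → ℕ | ∀ e ∈ incidentEdges (evenSite v),
      M * l1 (evenSite v) ≤ w e}.Infinite) : (deviantSites w μ ε).Infinite := by
  refine ((hinf.sdiff (Set.finite_singleton 0)).image evenSite_injective.injOn).mono ?_
  rintro _ ⟨v, ⟨hv, hv0⟩, rfl⟩
  have hT := le_travelTime_of_incidentEdges hw hv0 hv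
  obtain ⟨i, hi⟩ := Function.ne_iff.1 hv0
  have hl : (0 : ℝ) < l1 (evenSite v) := by
    exact_mod_cast (Nat.pos_of_ne_zero hi).trans_le (le_l1_evenSite v i)
  refine lt_of_lt_of_le ?_ (le_abs_self (travelTime w 0 (evenSite v) - μ (evenSite v)))
  nlinarith [hμ (evenSite v)]

/-- An isolated site `z` is in the ball of radius `(1 - ε) t` but not reached at time `t` for every
`t` between `C ‖z‖ / (1 - ε)` and `M ‖z‖`. -/
theorem volume_deviantTimes_eq_top (hw : ∀ e, 0 ≤ w e) (hC : 0 ≤ C) (hμ : ∀ z, μ z ≤ C * l1 z)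
    (hε : ε < 1) (hM : C / (1 - ε) + 1 ≤ M)
    (hinf : {v : Fin d → ℕ | ∀ e ∈ incidentEdges (evenSite v),
      M * l1 (evenSite v) ≤ w e}.Infinite) : volume (deviantTimes w μ ε) = ⊤ := by
  by_contra hne
  obtain ⟨k, hk⟩ := ENNReal.exists_nat_gt hne
  obtain ⟨v, hv, hvk⟩ := hinf.exists_notMem_finset (Finset.Iic fun _ => k)
  rw [Finset.mem_Iic, Pi.le_def, not_forall] at hvk
  obtain ⟨i, hi⟩ := hvk
  have hi : k < v i := not_le.1 hi
  have hT := le_travelTime_of_incidentEdges hw (by rintro rfl; simp at hi) hv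
  set l : ℝ := (l1 (evenSite v) : ℝ) with hl
  have hkl : (k : ℝ) ≤ l := by
    rw [hl, Nat.cast_le]
    exact (hi.trans_le (le_l1_evenSite v i)).le
  have hε' : 0 < 1 - ε := sub_pos.2 hε
  have hl0 : 0 ≤ l := Nat.cast_nonneg _
  have hsub : Set.Ico (C / (1 - ε) * l) (M * l) ⊆ deviantTimes w μ ε := by
    rintro t ⟨ht1, ht2⟩
    refine ⟨le_trans (by positivity) ht1, fun h => ?_⟩
    have hball : evenSite v ∈ discreteBall μ ((1 - ε) * t) := by
      refine (hμ _).trans ?_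
      calc C * l = (1 - ε) * (C / (1 - ε) * l) := by field_simp
        _ ≤ (1 - ε) * t := by gcongr
    exact not_le.2 (ht2.trans_le hT) (h.1 hball)
  have hvol := measure_mono (μ := volume) hsub
  rw [Real.volume_Ico] at hvol
  refine not_lt.2 hvol (hk.trans_le ?_)
  rw [← ENNReal.ofReal_natCast]
  refine ENNReal.ofReal_le_ofReal (hkl.trans ?_)
  nlinarith

end Deviation

end FPP

theorem mainTheorem8 {d : ℕ} (hd : 2 ≤ d)
    {Ω : Type*} [MeasurableSpace Ω] (P : Measure Ω) [IsProbabilityMeasure P]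
    (τ : FPP.Edge d → Ω → ℝ) (ν : Measure ℝ)
    (hmeas : ∀ e, Measurable (τ e))
    (hnonneg : ∀ e ω, 0 ≤ τ e ω)
    (hindep : iIndepFun τ P)
    (hlaw : ∀ e, P.map (τ e) = ν)
    (hY : FPP.momentMin d ν d = ⊤) :
    ∀ᵐ ω ∂P, ∀ ε : ℝ, 0 < ε →
      (FPP.deviantSites (fun e => τ e ω) (FPP.timeConstant P τ) ε).Infinite ∧
      (ε < 1 →
        volume (FPP.deviantTimes (fun e => τ e ω) (FPP.timeConstant P τ) ε) = ⊤) := by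
  have : IsProbabilityMeasure ν := by
    let e : FPP.Edge d :=
      ⟨s(0, 0 + Pi.single ⟨0, by omega⟩ 1), FPP.lattice_adj_add_single 0 _⟩
    rw [← hlaw e]
    exact Measure.isProbabilityMeasure_map (hmeas e).aemeasurable
  obtain ⟨C, hC, hμ⟩ := FPP.exists_timeConstant_le hd hmeas hnonneg hindep hlaw
  have hinf : ∀ᵐ ω ∂P, ∀ k : ℕ, {v : Fin d → ℕ | ∀ e ∈ FPP.incidentEdges (FPP.evenSite v),
      ((k : ℝ) + 1) * FPP.l1 (FPP.evenSite v) ≤ τ e ω}.Infinite :=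
    ae_all_iff.2 fun k => FPP.ae_infinite_heavy_evenSite (by omega) hmeas hnonneg hindep hlaw hY
      (by positivity)
  filter_upwards [hinf] with ω hω ε hε
  refine ⟨?_, fun hε1 => ?_⟩
  · obtain ⟨k, hk⟩ := exists_nat_gt (C + ε)
    exact FPP.infinite_deviantSites (hnonneg · ω) hμ (by linarith) (hω k)
  · obtain ⟨k, hk⟩ := exists_nat_gt (C / (1 - ε))
    exact FPP.volume_deviantTimes_eq_top (hnonneg · ω) hC hμ hε1 (by linarith) (hω k)
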